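/- Let $D$ be a natural number, $\lambda>0$, $\phi\in(0,\pi/2]$, and let $\Phi\in C^2(\mathbb{R}^D)$. Put $$H(q,p)=\tfrac12|p|^2+\Phi(q),\qquad C_0=\int_{\mathbb{R}^D}e^{-\Phi(q)}\,dq,\qquad \Pi_{\mathrm{BG}}(dq,dp)=C_0^{-1}(2\pi)^{-D/2}e^{-H(q,p)}\,dq\,dp,$$ $$c_1=\tfrac{\lambda^{-1}}{4}\sin^2\phi,\qquad c_2=\lambda^{-1}c_1(1-\cos\phi).$$ Assume - **H1.** $\Phi(q)\ge 0$ for all $q$, and $\int_{\mathbb{R}^D}|q|^2e^{-\Phi(q)}\,dq<\infty$; - **H2.** there exist $a>0$ and $b\in(0,1)$ such that for all $q\in\mathbb{R}^D$ $$\tfrac12\langle\nabla\Phi(q),q\rangle\ \ge\ b\,\Phi(q)+\frac{(c_1b)^2+c_2b(1-b)}{2(1-b)}|q|^2-a .$$ Let $(\theta_t)_{t\in\mathbb{R}}$ be the flow on $\mathbb{R}^{2D}$ of Hamilton's equations $\dot q=p$, $\dot p=-\nabla\Phi(q)$. On a probability space let $\delta_0,\delta_1,\dots$ be exponential random variables with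 mean $\lambda$ and $\xi_0,\xi_1,\dots$ standard normal random vectors in $\mathbb{R}^D$, all mutually independent. The RHMC process $(Z_t)_{t\ge0}$ started at $z\in\mathbb{R}^{2D}$ is given by $t_0=0$, $Z_{0}=z$, $t_{k+1}=t_k+\delta_k$, $Z_t=\theta_{t-t_k}(Z_{t_k})$ for $t_k\le t<t_{k+1}$, and $$Z_{t_{k+1}}=(q,\ \cos(\phi)\,p+\sin(\phi)\,\xi_k)\quad\text{where }(q,p)=\theta_{\delta_k}(Z_{t_k}).$$ Write $\mathbb{E}_z$ for the expectation when $Z_0=z$. Then $\Pi_{\mathrm{BG}}$ is a probability measure and is invariant for the RHMC process: for every $f\in C_c^\infty(\mathbb{R}^{2D})$ and every $t>0$, $$\int_{\mathbb{R}^{2D}}\mathbb{E}_z f(Z_t)\,\Pi_{\mathrm{BG}}(dz)=\int_{\mathbb{R}^{2D}}f(z)\,\Pi_{\mathrm{BG}}(dz),$$ where $f(Z_t)$ is integrable for every initial point $z$, and $z\mapsto\mathbb{E}_zf(Z_t)$ is $\Pi_{\mathrm{BG}}$-integrable. -/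

import Mathlib

namespace RHMC

open MeasureTheory ProbabilityTheory

/-- Configuration (or momentum) space `ℝ^D` with its Euclidean norm and Lebesgue measure. -/
abbrev Vec (D : ℕ) : Type := EuclideanSpace ℝ (Fin D)

/-- Phase space `ℝ^{2D}`, with points `z = (q, p)`. -/
abbrev Phase (D : ℕ) : Type := Vec D × Vec D

/-- The Hamiltonian `H(q, p) = |p|² / 2 + Φ(q)`. -/
noncomputable def hamiltonian {D : ℕ} (Φ : Vec D → ℝ) (z : Phase D) : ℝ :=
  ‖z.2‖ ^ 2 / 2 + Φ z.1

/-- The normalization constant `C₀ = ∫ exp(-Φ(q)) dq`. -/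
noncomputable def normConst {D : ℕ} (Φ : Vec D → ℝ) : ℝ :=
  ∫ q, Real.exp (-Φ q)

/-- The Boltzmann-Gibbs measure `C₀⁻¹ (2π)^{-D/2} exp(-H(q, p)) dq dp` on phase space. -/
noncomputable def boltzmannGibbs {D : ℕ} (Φ : Vec D → ℝ) : Measure (Phase D) :=
  (volume : Measure (Phase D)).withDensity fun z =>
    ENNReal.ofReal ((normConst Φ)⁻¹ * (2 * Real.pi) ^ (-(D : ℝ) / 2) *
      Real.exp (-hamiltonian Φ z))

/-- `γ` solves Hamilton's equations `q' = p`, `p' = -∇Φ(q)` for all real times. -/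
def IsHamiltonianSolution {D : ℕ} (Φ : Vec D → ℝ) (γ : ℝ → Phase D) : Prop :=
  ∀ s : ℝ, HasDerivAt γ ((γ s).2, -gradient Φ (γ s).1) s

open Classical in
/-- The Hamiltonian flow map `θ_t(z)`: the value at time `t` of the global solution of Hamilton's
equations that starts at `z`. (If `Φ` is `C²` and bounded below, this solution exists and is unique
for every `z`; the value in the other case is irrelevant.) -/
noncomputable def flow {D : ℕ} (Φ : Vec D → ℝ) (t : ℝ) (z : Phase D) : Phase D :=
  if h : ∃ γ : ℝ → Phase D, γ 0 = z ∧ IsHamiltonianSolution Φ γ then h.choose t else z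

/-- Momentum randomization `(q, p) ↦ (q, cos(φ) p + sin(φ) ξ)`. -/
noncomputable def refresh {D : ℕ} (φ : ℝ) (ξ : Vec D) (z : Phase D) : Phase D :=
  (z.1, Real.cos φ • z.2 + Real.sin φ • ξ)

/-- The randomization times `t_k = δ_0 + ⋯ + δ_{k-1}`, with `t_0 = 0`. -/
noncomputable def jumpTime (δ : ℕ → ℝ) (k : ℕ) : ℝ :=
  ∑ i ∈ Finset.range k, δ i

/-- The state `Z_{t_k}` right after the `k`-th randomization, for the initial state `z`, the
durations `δ` and the Gaussian vectors `ξ`: follow the flow for time `δ_k`, then randomize. -/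
noncomputable def stateAtJump {D : ℕ} (Φ : Vec D → ℝ) (φ : ℝ) (δ : ℕ → ℝ) (ξ : ℕ → Vec D)
    (z : Phase D) : ℕ → Phase D
  | 0 => z
  | k + 1 => refresh φ (ξ k) (flow Φ (δ k) (stateAtJump Φ φ δ ξ z k))

/-- The number of randomizations up to and including time `t`, that is, the `k` with
`t_k ≤ t < t_{k+1}` (almost surely the set below is finite). -/
noncomputable def numJumps (δ : ℕ → ℝ) (t : ℝ) : ℕ :=
  sSup {k : ℕ | jumpTime δ k ≤ t}

/-- The RHMC path: `Z_t = θ_{t - t_k}(Z_{t_k})` for `t_k ≤ t < t_{k+1}`. -/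
noncomputable def path {D : ℕ} (Φ : Vec D → ℝ) (φ : ℝ) (δ : ℕ → ℝ) (ξ : ℕ → Vec D)
    (z : Phase D) (t : ℝ) : Phase D :=
  flow Φ (t - jumpTime δ (numJumps δ t)) (stateAtJump Φ φ δ ξ z (numJumps δ t))

/-- The random inputs of RHMC: durations `δ_k`, exponentially distributed with mean `lam` (rate
`1 / lam`), and standard normal vectors `ξ_k`, all of them mutually independent. -/
structure IsNoise {D : ℕ} {Ω : Type*} [MeasurableSpace Ω] (P : Measure Ω) (lam : ℝ)
    (δ : ℕ → Ω → ℝ) (ξ : ℕ → Ω → Vec D) : Prop where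
  law_duration : ∀ k, HasLaw (δ k) (expMeasure (1 / lam)) P
  law_gaussian : ∀ k, HasLaw (ξ k) (stdGaussian (Vec D)) P
  indep_duration : iIndepFun δ P
  indep_gaussian : iIndepFun ξ P
  indep : IndepFun (fun ω k => δ k ω) (fun ω k => ξ k ω) P

/-- The constant `c₁ = λ⁻¹ sin²(φ) / 4`. -/
noncomputable def c₁ (lam φ : ℝ) : ℝ := lam⁻¹ / 4 * Real.sin φ ^ 2

/-- The constant `c₂ = λ⁻¹ c₁ (1 - cos(φ))`. -/
noncomputable def c₂ (lam φ : ℝ) : ℝ := lam⁻¹ * c₁ lam φ * (1 - Real.cos φ)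

/-- Condition H1: `Φ ≥ 0` and `∫ |q|² exp(-Φ(q)) dq < ∞`. -/
def H1 {D : ℕ} (Φ : Vec D → ℝ) : Prop :=
  (∀ q, 0 ≤ Φ q) ∧ Integrable (fun q : Vec D => ‖q‖ ^ 2 * Real.exp (-Φ q)) volume

/-- Condition H2: for some `a > 0` and `b ∈ (0, 1)`, for all `q`,
`⟨∇Φ(q), q⟩ / 2 ≥ b Φ(q) + ((c₁ b)² + c₂ b (1 - b)) / (2 (1 - b)) |q|² - a`. -/
def H2 {D : ℕ} (Φ : Vec D → ℝ) (lam φ : ℝ) : Prop :=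
  ∃ a b : ℝ, 0 < a ∧ 0 < b ∧ b < 1 ∧ ∀ q : Vec D,
    1 / 2 * inner ℝ (gradient Φ q) q ≥
      b * Φ q + ((c₁ lam φ * b) ^ 2 + c₂ lam φ * b * (1 - b)) / (2 * (1 - b)) * ‖q‖ ^ 2 - a

end RHMC

/-!
The Boltzmann-Gibbs measure is invariant because both ingredients of the process preserve it, and
because the durations are independent of the Gaussian vectors.

*The flow.* Since `Φ ≥ 0`, conservation of energy bounds the speed of a trajectory, so on a bounded
time interval a trajectory does not leave a ball and coincides with one for the compactly supported
potential `cutoff Φ n`, whose vector field is globally Lipschitz. This gives global existence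
(`exists_isHamiltonianSolution`), and `flow Φ t z` is the limit of `flow (cutoff Φ n) t z`
(`tendsto_flow_cutoff`). Liouville's theorem (`measurePreserving_flow`) is obtained without
differentiating the flow with respect to the initial point: for a Lipschitz force the flow is the
pointwise limit of symplectic Euler iterates (`tendsto_eulerStep_iterate`), each of which is a
composition of shears and so preserves the volume. By Fatou's lemma a pointwise limit of such maps
pushes the volume to a measure that is at most the volume (`map_le_of_tendsto`), and this inequality
for the times `t` and `-t` yields equality. The same limits show that the flow is jointly
measurable. Volume and energy being preserved, so is the Boltzmann-Gibbs measure.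

*The randomization.* The Boltzmann-Gibbs measure is the product of a law of the position and the
standard Gaussian law of the momentum (`boltzmannGibbs_eq_prod`), and `cos φ • p + sin φ • ξ` is
standard Gaussian for independent standard Gaussian `p` and `ξ`.

*The process.* Given the durations, the number of randomizations before time `t` is deterministic
and the path up to time `t` is a finite composition of flow maps and independent randomizations, so its
endpoint has the Boltzmann-Gibbs law when its starting point has (`lintegral_stateAtJump`).
Averaging over the durations, which are independent of the Gaussian vectors, gives `measurePreserving_path`.
-/

namespace RHMC

open MeasureTheory ProbabilityTheory Set Filter Topology
open scoped Manifold NNReal ENNReal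

/-! ### Autonomous differential equations -/

section ODE

variable {E : Type*} [NormedAddCommGroup E] [NormedSpace ℝ E]

lemma isMIntegralCurveOn_iff_hasDerivAt {γ : ℝ → E} {v : E → E} {s : Set ℝ} (hs : IsOpen s) :
    IsMIntegralCurveOn (I := 𝓘(ℝ, E)) γ v s ↔ ∀ t ∈ s, HasDerivAt γ (v (γ t)) t := by
  refine forall₂_congr fun t ht => ?_
  exact hasMFDerivWithinAt_iff_hasFDerivWithinAt.trans (hasFDerivWithinAt_of_isOpen hs ht)

/-- Two solutions of an autonomous equation with a `C¹` right-hand side that agree at one time of an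
open interval agree on the whole interval. -/
lemma eqOn_Ioo_of_hasDerivAt_of_contDiff [CompleteSpace E] {v : E → E} (hv : ContDiff ℝ 1 v)
    {γ γ' : ℝ → E} {a b t₀ : ℝ} (ht₀ : t₀ ∈ Ioo a b)
    (hγ : ∀ t ∈ Ioo a b, HasDerivAt γ (v (γ t)) t)
    (hγ' : ∀ t ∈ Ioo a b, HasDerivAt γ' (v (γ' t)) t) (h : γ t₀ = γ' t₀) :
    EqOn γ γ' (Ioo a b) :=
  isMIntegralCurveOn_Ioo_eqOn_of_contMDiff_boundaryless (I := 𝓘(ℝ, E)) ht₀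
    (contMDiff_vectorSpace_iff_contDiff.2 hv)
    ((isMIntegralCurveOn_iff_hasDerivAt isOpen_Ioo).2 hγ)
    ((isMIntegralCurveOn_iff_hasDerivAt isOpen_Ioo).2 hγ') h

/-- Solutions on all bounded intervals around `0` glue to a global solution, by uniqueness. -/
lemma exists_hasDerivAt_of_forall_Ioo [CompleteSpace E] {v : E → E} (hv : ContDiff ℝ 1 v) (x : E)
    (h : ∀ a : ℝ, ∃ γ : ℝ → E, γ 0 = x ∧ ∀ t ∈ Ioo (-a) a, HasDerivAt γ (v (γ t)) t) :
    ∃ γ : ℝ → E, γ 0 = x ∧ ∀ t, HasDerivAt γ (v (γ t)) t := by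
  have := (exists_isMIntegralCurve_iff_exists_isMIntegralCurveOn_Ioo (I := 𝓘(ℝ, E))
    (contMDiff_vectorSpace_iff_contDiff.2 hv) x).2 fun a => by
      obtain ⟨γ, h0, hγ⟩ := h a
      exact ⟨γ, h0, (isMIntegralCurveOn_iff_hasDerivAt isOpen_Ioo).2 hγ⟩
  obtain ⟨γ, h0, hγ⟩ := this
  exact ⟨γ, h0, fun t => (isMIntegralCurveOn_iff_hasDerivAt isOpen_univ).1
    (hγ.isMIntegralCurveOn univ) t (mem_univ t)⟩

/-- A globally Lipschitz `C¹` vector field has global solutions. -/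
lemma exists_hasDerivAt_of_lipschitzWith [CompleteSpace E] {v : E → E} (hv : ContDiff ℝ 1 v)
    {K : ℝ≥0} (hK : LipschitzWith K v) (x : E) :
    ∃ γ : ℝ → E, γ 0 = x ∧ ∀ t, HasDerivAt γ (v (γ t)) t := by
  -- the length of the interval in the Picard-Lindelöf theorem can be taken independent of `x`
  set ε : ℝ := 1 / (2 * (K + 1)) with hε
  have hε0 : 0 < ε := by positivity
  have key : ∀ x : E, ∃ γ : ℝ → E, γ 0 = x ∧
      IsMIntegralCurveOn (I := 𝓘(ℝ, E)) γ v (Ioo (-ε) ε) := by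
    intro x
    -- `‖v‖ ≤ L` on the ball of radius `a` around `x`, and `L * ε ≤ a`
    let a : ℝ≥0 := ‖v x‖₊ / (K + 1)
    let L : ℝ≥0 := ‖v x‖₊ + K * a
    have hpl : IsPicardLindelof (fun _ => v) (tmin := -ε) (tmax := ε)
        ⟨0, by constructor <;> linarith⟩ x a 0 L K := by
      refine IsPicardLindelof.of_time_independent (fun y hy => ?_) hK.lipschitzOnWith ?_
      · have h1 : ‖v y - v x‖ ≤ K * a := by
          refine (hK.norm_sub_le y x).trans ?_
          gcongr
          simpa [dist_eq_norm] using hy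
        calc ‖v y‖ = ‖v x + (v y - v x)‖ := by abel_nf
          _ ≤ ‖v x‖ + ‖v y - v x‖ := norm_add_le _ _
          _ ≤ L := by simp only [L]; push_cast; simpa using h1
      · have hK1 : (0 : ℝ) < K + 1 := by positivity
        simp only [L, a, hε]
        push_cast
        simp only [sub_zero, zero_sub, neg_neg, max_self]
        rw [mul_one_div, div_le_iff₀ (by positivity)]
        field_simp
        nlinarith [norm_nonneg (v x), K.2]
    obtain ⟨γ, h0, hγ⟩ := hpl.exists_eq_forall_mem_Icc_hasDerivWithinAt₀
    exact ⟨γ, h0, (isMIntegralCurveOn_iff_hasDerivAt isOpen_Ioo).2 fun t ht =>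
      (hγ t (Ioo_subset_Icc_self ht)).hasDerivAt (Icc_mem_nhds ht.1 ht.2)⟩
  obtain ⟨γ, h0, hγ⟩ := exists_isMIntegralCurve_of_isMIntegralCurveOn (I := 𝓘(ℝ, E))
    (contMDiff_vectorSpace_iff_contDiff.2 hv) hε0 key x
  exact ⟨γ, h0, fun t => (isMIntegralCurveOn_iff_hasDerivAt isOpen_univ).1
    (hγ.isMIntegralCurveOn univ) t (mem_univ t)⟩

end ODE

/-! ### Existence, uniqueness and energy of Hamiltonian trajectories -/

section Hamiltonian

variable {D : ℕ} {Φ Ψ : Vec D → ℝ}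

/-- The vector field `(q, p) ↦ (p, -∇Φ(q))` of Hamilton's equations. -/
noncomputable def hamiltonianField (Φ : Vec D → ℝ) (z : Phase D) : Phase D :=
  (z.2, -gradient Φ z.1)

lemma contDiff_gradient (hΦ : ContDiff ℝ 2 Φ) : ContDiff ℝ 1 (gradient Φ) :=
  (InnerProductSpace.toDual ℝ (Vec D)).symm.contDiff.comp (hΦ.fderiv_right (by norm_num))

lemma contDiff_hamiltonianField (hΦ : ContDiff ℝ 2 Φ) :
    ContDiff ℝ 1 (hamiltonianField Φ) :=
  contDiff_snd.prodMk ((contDiff_gradient hΦ).comp contDiff_fst).neg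

/-- Conservation of energy. -/
lemma hamiltonian_eq_of_hasDerivAt (hΦ : ContDiff ℝ 2 Φ) {γ : ℝ → Phase D} {T : ℝ}
    (hγ : ∀ t ∈ Ioo (-T) T, HasDerivAt γ (hamiltonianField Φ (γ t)) t) {t : ℝ}
    (ht : t ∈ Ioo (-T) T) : hamiltonian Φ (γ t) = hamiltonian Φ (γ 0) := by
  have hd : ∀ s ∈ Ioo (-T) T, HasDerivAt (fun s => hamiltonian Φ (γ s)) 0 s := by
    intro s hs
    have h1 : HasDerivAt (fun s => (γ s).1) (γ s).2 s := (hγ s hs).fst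
    have h2 : HasDerivAt (fun s => (γ s).2) (-gradient Φ (γ s).1) s := (hγ s hs).snd
    have h3 := (h2.norm_sq).div_const 2
    have hg : HasGradientAt Φ (gradient Φ (γ s).1) (γ s).1 :=
      (hΦ.differentiable (by norm_num) _).hasGradientAt
    have h4 := hg.hasFDerivAt.comp_hasDerivAt s h1
    have h5 := h3.add h4
    refine HasDerivAt.congr_deriv (f := fun s => hamiltonian Φ (γ s)) h5 ?_
    rw [InnerProductSpace.toDual_apply_apply, inner_neg_right, real_inner_comm]
    ring
  have h0 : (0 : ℝ) ∈ Ioo (-T) T := by constructor <;> linarith [ht.1, ht.2]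
  exact (isOpen_Ioo.is_const_of_deriv_eq_zero isPreconnected_Ioo
    (fun s hs => (hd s hs).differentiableAt.differentiableWithinAt)
    (fun s hs => (hd s hs).deriv) ht h0)

/-- Since `Φ ≥ 0`, conservation of energy bounds the speed, hence the displacement. -/
lemma norm_sub_le_of_hasDerivAt (hΦ : ContDiff ℝ 2 Φ) (h0 : ∀ q, 0 ≤ Φ q) {γ : ℝ → Phase D}
    {T : ℝ} (hγ : ∀ t ∈ Ioo (-T) T, HasDerivAt γ (hamiltonianField Φ (γ t)) t) {t : ℝ}
    (ht : t ∈ Ioo (-T) T) :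
    ‖(γ t).1 - (γ 0).1‖ ≤ √(2 * hamiltonian Φ (γ 0)) * |t| := by
  have hT : (0 : ℝ) ∈ Ioo (-T) T := by constructor <;> linarith [ht.1, ht.2]
  have := (convex_Ioo (-T) T).norm_image_sub_le_of_norm_hasDerivWithin_le
    (f := fun s => (γ s).1) (f' := fun s => (γ s).2) (C := √(2 * hamiltonian Φ (γ 0)))
    (fun s hs => (show HasDerivAt (fun s => (γ s).1) (γ s).2 s from
      (hγ s hs).fst).hasDerivWithinAt) (fun s hs => ?_) hT ht
  · simpa using this
  · apply Real.le_sqrt_of_sq_le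
    have := hamiltonian_eq_of_hasDerivAt hΦ hγ hs
    rw [← this, hamiltonian]
    linarith [h0 (γ s).1]

/-- The potential cut off to a compact set by a smooth bump function that is `1` on the closed ball
of radius `n + 1`. -/
noncomputable def cutoff (Φ : Vec D → ℝ) (n : ℕ) (q : Vec D) : ℝ :=
  (⟨n + 1, n + 2, by positivity, by linarith⟩ : ContDiffBump (0 : Vec D)) q * Φ q

lemma contDiff_cutoff (hΦ : ContDiff ℝ 2 Φ) (n : ℕ) : ContDiff ℝ 2 (cutoff Φ n) :=
  (ContDiffBump.contDiff _).mul hΦ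

lemma cutoff_nonneg (h0 : ∀ q, 0 ≤ Φ q) (n : ℕ) (q : Vec D) : 0 ≤ cutoff Φ n q :=
  mul_nonneg (ContDiffBump.nonneg _) (h0 q)

lemma cutoff_eq (n : ℕ) {q : Vec D} (hq : ‖q‖ ≤ n + 1) : cutoff Φ n q = Φ q := by
  rw [cutoff, ContDiffBump.one_of_mem_closedBall, one_mul]
  simpa using hq

lemma gradient_cutoff_eq (n : ℕ) {q : Vec D} (hq : ‖q‖ < n + 1) :
    gradient (cutoff Φ n) q = gradient Φ q := by
  refine (Filter.EventuallyEq.gradient ?_).self_of_nhds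
  filter_upwards [(isOpen_lt continuous_norm continuous_const).mem_nhds hq] with y hy
  exact cutoff_eq n (le_of_lt hy)

lemma hasCompactSupport_cutoff (Φ : Vec D → ℝ) (n : ℕ) : HasCompactSupport (cutoff Φ n) :=
  (ContDiffBump.hasCompactSupport _).mul_right

lemma exists_lipschitzWith_gradient (hΦ : ContDiff ℝ 2 Φ) (hc : HasCompactSupport Φ) :
    ∃ K, LipschitzWith K (gradient Φ) := by
  have hc' : HasCompactSupport (gradient Φ) := by
    have := (hc.fderiv (𝕜 := ℝ))
    exact this.comp_left (g := (InnerProductSpace.toDual ℝ (Vec D)).symm) (map_zero _)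
  exact (contDiff_gradient hΦ).lipschitzWith_of_hasCompactSupport hc' (by norm_num)

lemma exists_isHamiltonianSolution_of_hasCompactSupport (hΦ : ContDiff ℝ 2 Φ)
    (hc : HasCompactSupport Φ) (z : Phase D) :
    ∃ γ : ℝ → Phase D, γ 0 = z ∧ IsHamiltonianSolution Φ γ := by
  obtain ⟨K, hK⟩ := exists_lipschitzWith_gradient hΦ hc
  exact exists_hasDerivAt_of_lipschitzWith (contDiff_hamiltonianField hΦ)
    (LipschitzWith.prod_snd.prodMk (hK.comp LipschitzWith.prod_fst).neg) z

lemma hamiltonianField_congr {z : Phase D} (h : gradient Ψ z.1 = gradient Φ z.1) :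
    hamiltonianField Ψ z = hamiltonianField Φ z := by
  simp [hamiltonianField, h]

/-- Solutions for the cut-off potential solve the original equations as long as the a priori bound
on the displacement keeps them in the ball where the two potentials agree. -/
lemma hasDerivAt_of_cutoff (hΦ : ContDiff ℝ 2 Φ) (h0 : ∀ q, 0 ≤ Φ q) {γ : ℝ → Phase D} {T : ℝ}
    {n : ℕ} (hγ : ∀ t ∈ Ioo (-T) T, HasDerivAt γ (hamiltonianField (cutoff Φ n) (γ t)) t)
    (hn : ‖(γ 0).1‖ + √(2 * hamiltonian Φ (γ 0)) * T ≤ n) {t : ℝ} (ht : t ∈ Ioo (-T) T) :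
    HasDerivAt γ (hamiltonianField Φ (γ t)) t := by
  rw [← hamiltonianField_congr (gradient_cutoff_eq n ?_)]
  · exact hγ t ht
  have hT : 0 ≤ T := by linarith [ht.1, ht.2]
  have hs := Real.sqrt_nonneg (2 * hamiltonian Φ (γ 0))
  have hH : hamiltonian (cutoff Φ n) (γ 0) = hamiltonian Φ (γ 0) := by
    rw [hamiltonian, cutoff_eq, hamiltonian]
    nlinarith
  have := norm_sub_le_of_hasDerivAt (contDiff_cutoff hΦ n) (cutoff_nonneg h0 n) hγ ht
  rw [hH] at this
  have h2 : √(2 * hamiltonian Φ (γ 0)) * |t| ≤ √(2 * hamiltonian Φ (γ 0)) * T :=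
    mul_le_mul_of_nonneg_left (abs_lt.2 ht).le hs
  have h3 := norm_le_norm_add_norm_sub' (γ t).1 (γ 0).1
  linarith

lemma exists_isHamiltonianSolution (hΦ : ContDiff ℝ 2 Φ) (h0 : ∀ q, 0 ≤ Φ q) (z : Phase D) :
    ∃ γ : ℝ → Phase D, γ 0 = z ∧ IsHamiltonianSolution Φ γ := by
  refine exists_hasDerivAt_of_forall_Ioo (contDiff_hamiltonianField hΦ) z fun T => ?_
  obtain ⟨n, hn⟩ := exists_nat_ge (‖z.1‖ + √(2 * hamiltonian Φ z) * T)
  obtain ⟨γ, rfl, hγ⟩ := exists_isHamiltonianSolution_of_hasCompactSupport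
    (contDiff_cutoff hΦ n) (hasCompactSupport_cutoff Φ n) z
  exact ⟨γ, rfl, fun t ht => hasDerivAt_of_cutoff hΦ h0 (fun t _ => hγ t) hn ht⟩

lemma flow_zero (hΦ : ContDiff ℝ 2 Φ) (h0 : ∀ q, 0 ≤ Φ q) (z : Phase D) : flow Φ 0 z = z := by
  have h := exists_isHamiltonianSolution hΦ h0 z
  rw [flow, dif_pos h]
  exact h.choose_spec.1

lemma isHamiltonianSolution_flow (hΦ : ContDiff ℝ 2 Φ) (h0 : ∀ q, 0 ≤ Φ q) (z : Phase D) :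
    IsHamiltonianSolution Φ (fun t => flow Φ t z) := by
  have h := exists_isHamiltonianSolution hΦ h0 z
  simp only [flow, dif_pos h]
  exact h.choose_spec.2

/-- Every solution of Hamilton's equations on an open interval around `0` is given by the flow. -/
lemma flow_eq_of_hasDerivAt (hΦ : ContDiff ℝ 2 Φ) (h0 : ∀ q, 0 ≤ Φ q) {γ : ℝ → Phase D} {T : ℝ}
    (hγ : ∀ t ∈ Ioo (-T) T, HasDerivAt γ (hamiltonianField Φ (γ t)) t) {t : ℝ}
    (ht : t ∈ Ioo (-T) T) : flow Φ t (γ 0) = γ t :=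
  eqOn_Ioo_of_hasDerivAt_of_contDiff (contDiff_hamiltonianField hΦ) (t₀ := 0)
    (by constructor <;> linarith [ht.1, ht.2])
    (fun t _ => isHamiltonianSolution_flow hΦ h0 (γ 0) t) hγ (flow_zero hΦ h0 _) ht

lemma flow_add (hΦ : ContDiff ℝ 2 Φ) (h0 : ∀ q, 0 ≤ Φ q) (s t : ℝ) (z : Phase D) :
    flow Φ (s + t) z = flow Φ s (flow Φ t z) := by
  have := flow_eq_of_hasDerivAt hΦ h0 (γ := fun u => flow Φ (u + t) z) (T := |s| + 1)
    (fun u _ => (isHamiltonianSolution_flow hΦ h0 z (u + t)).comp_add_const u t) (t := s)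
    (abs_lt.1 (by linarith))
  simpa using this.symm

lemma hamiltonian_flow (hΦ : ContDiff ℝ 2 Φ) (h0 : ∀ q, 0 ≤ Φ q) (t : ℝ) (z : Phase D) :
    hamiltonian Φ (flow Φ t z) = hamiltonian Φ z := by
  have := hamiltonian_eq_of_hasDerivAt hΦ (γ := fun t => flow Φ t z) (T := |t| + 1)
    (fun t _ => isHamiltonianSolution_flow hΦ h0 z t) (t := t) (abs_lt.1 (by linarith))
  simpa [flow_zero hΦ h0] using this

/-- The sequence is eventually constant, since the trajectory stays in a ball until time `t`. -/
lemma tendsto_flow_cutoff (hΦ : ContDiff ℝ 2 Φ) (h0 : ∀ q, 0 ≤ Φ q) (t : ℝ) (z : Phase D) :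
    Tendsto (fun n => flow (cutoff Φ n) t z) atTop (𝓝 (flow Φ t z)) := by
  obtain ⟨N, hN⟩ := exists_nat_ge (‖z.1‖ + √(2 * hamiltonian Φ z) * (|t| + 1))
  refine tendsto_const_nhds.congr' ?_
  filter_upwards [eventually_ge_atTop N] with n hn
  have hz := flow_zero (contDiff_cutoff hΦ n) (cutoff_nonneg h0 n) z
  have := flow_eq_of_hasDerivAt hΦ h0 (γ := fun t => flow (cutoff Φ n) t z) (T := |t| + 1) (t := t)
    (fun s hs => hasDerivAt_of_cutoff hΦ h0
      (fun s _ => isHamiltonianSolution_flow (contDiff_cutoff hΦ n) (cutoff_nonneg h0 n) z s)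
      (by simp only [hz]; exact hN.trans (by exact_mod_cast hn)) hs) (abs_lt.1 (by linarith))
  simpa [hz] using this

end Hamiltonian

/-! ### The symplectic Euler scheme -/

section Euler

variable {D : ℕ}

/-- One step of size `h` of the symplectic Euler scheme for `q' = p`, `p' = F(q)`. -/
def eulerStep (F : Vec D → Vec D) (h : ℝ) (z : Phase D) : Phase D :=
  (z.1 + h • z.2, z.2 + h • F (z.1 + h • z.2))

/-- Mean value inequality for the deviation of `f` from the affine function with slope `c`. -/
lemma norm_sub_sub_smul_le {E : Type*} [NormedAddCommGroup E] [NormedSpace ℝ E] {f f' : ℝ → E}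
    {s r C : ℝ} {c : E} (hf : ∀ u, HasDerivAt f (f' u) u)
    (hC : ∀ u ∈ uIcc s r, ‖f' u - c‖ ≤ C) : ‖f r - f s - (r - s) • c‖ ≤ C * |r - s| := by
  have h := (convex_uIcc s r).norm_image_sub_le_of_norm_hasDerivWithin_le
    (f := fun u => f u - u • c) (f' := fun u => f' u - c) (C := C)
    (fun u _ => ((hf u).sub ((hasDerivAt_id u).smul_const c)).hasDerivWithinAt.congr_deriv
      (by simp)) hC
    left_mem_uIcc right_mem_uIcc
  rw [Real.norm_eq_abs] at h
  convert h using 2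
  rw [sub_smul]; abel

/-- A discrete Grönwall inequality on a finite range of indices, for a sequence starting at `0`. -/
lemma le_mul_exp_of_le_one_add_mul_add {u : ℕ → ℝ} {n : ℕ} {c b : ℝ} (hc : 0 ≤ c) (hb : 0 ≤ b)
    (h0 : u 0 = 0) (hu : ∀ k < n, u (k + 1) ≤ (1 + c) * u k + b) :
    ∀ k ≤ n, u k ≤ k * b * Real.exp (c * k) := by
  intro k
  induction k with
  | zero => simp [h0]
  | succ k ih =>
    intro hk
    have h1 := ih (by omega)
    have h2 := hu k (by omega)
    have h3 : 1 + c ≤ Real.exp c := by linarith [Real.add_one_le_exp c]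
    have h4 : Real.exp (c * ((k + 1 : ℕ) : ℝ)) = Real.exp c * Real.exp (c * k) := by
      rw [← Real.exp_add]; push_cast; ring_nf
    have h5 : 1 ≤ Real.exp (c * ((k + 1 : ℕ) : ℝ)) := Real.one_le_exp (by positivity)
    calc u (k + 1) ≤ (1 + c) * u k + b := h2
      _ ≤ Real.exp c * (k * b * Real.exp (c * k)) + b * Real.exp (c * ((k + 1 : ℕ) : ℝ)) := by
        have : (1 + c) * u k ≤ Real.exp c * (k * b * Real.exp (c * k)) :=
          (mul_le_mul_of_nonneg_left h1 (by linarith)).trans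
            (mul_le_mul_of_nonneg_right h3 (by positivity))
        nlinarith
      _ = ((k + 1 : ℕ) : ℝ) * b * Real.exp (c * ((k + 1 : ℕ) : ℝ)) := by
        rw [h4]; push_cast; ring

/-- How one symplectic Euler step propagates the sum of the position and the momentum error. -/
lemma eulerStep_error_le {F : Vec D → Vec D} {K : ℝ≥0} (hF : LipschitzWith K F)
    {γ : ℝ → Phase D} (hγ : ∀ s, HasDerivAt γ ((γ s).2, F (γ s).1) s) {T B : ℝ}
    (hB : ∀ s ∈ Icc (-T) T, ‖(γ s).2‖ ≤ B ∧ ‖F (γ s).1‖ ≤ B) {s h : ℝ}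
    (hs : s ∈ Icc (-T) T) (hsh : s + h ∈ Icc (-T) T) (hh : |h| ≤ 1) (z : Phase D) :
    ‖(γ (s + h)).1 - (eulerStep F h z).1‖ + ‖(γ (s + h)).2 - (eulerStep F h z).2‖ ≤
      (1 + (1 + 2 * K) * |h|) * (‖(γ s).1 - z.1‖ + ‖(γ s).2 - z.2‖) +
        (1 + 2 * K) * B * |h| ^ 2 := by
  have hq : ∀ s, HasDerivAt (fun s => (γ s).1) (γ s).2 s := fun s => (hγ s).fst
  have hp : ∀ s, HasDerivAt (fun s => (γ s).2) (F (γ s).1) s := fun s => (hγ s).snd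
  have hK := K.2
  have hB0 : 0 ≤ B := (norm_nonneg _).trans (hB s hs).1
  have hsub : uIcc s (s + h) ⊆ Icc (-T) T := ordConnected_Icc.uIcc_subset hs hsh
  have hlq : ∀ u ∈ Icc (-T) T, ∀ v ∈ Icc (-T) T, ‖(γ v).1 - (γ u).1‖ ≤ B * |v - u| := by
    intro u hu v hv
    exact (convex_Icc (-T) T).norm_image_sub_le_of_norm_hasDerivWithin_le
      (fun w _ => (hq w).hasDerivWithinAt) (fun w hw => (hB w hw).1) hu hv
  have hlp : ∀ u ∈ Icc (-T) T, ∀ v ∈ Icc (-T) T, ‖(γ v).2 - (γ u).2‖ ≤ B * |v - u| := by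
    intro u hu v hv
    exact (convex_Icc (-T) T).norm_image_sub_le_of_norm_hasDerivWithin_le
      (fun w _ => (hp w).hasDerivWithinAt) (fun w hw => (hB w hw).2) hu hv
  -- local errors of the two half-steps
  have e1 : ‖(γ (s + h)).1 - (γ s).1 - h • (γ s).2‖ ≤ B * |h| * |h| := by
    have := norm_sub_sub_smul_le (s := s) (r := s + h) (c := (γ s).2) (C := B * |h|) hq
      fun u hu => by
        refine (hlp s hs u (hsub hu)).trans ?_
        refine mul_le_mul_of_nonneg_left ?_ hB0
        simpa using abs_sub_left_of_mem_uIcc hu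
    simpa using this
  have e2 : ‖(γ (s + h)).2 - (γ s).2 - h • F (γ (s + h)).1‖ ≤ K * (B * |h|) * |h| := by
    have := norm_sub_sub_smul_le (s := s) (r := s + h) (c := F (γ (s + h)).1)
      (C := K * (B * |h|)) hp
      fun u hu => by
        refine (hF.norm_sub_le _ _).trans ?_
        refine mul_le_mul_of_nonneg_left ?_ hK
        refine (hlq _ hsh u (hsub hu)).trans ?_
        refine mul_le_mul_of_nonneg_left ?_ hB0
        have := abs_sub_right_of_mem_uIcc hu
        rw [abs_sub_comm] at this
        simpa using this
    simpa using this
  -- adding the propagated errors; the second half-step sees the new position error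
  have f1 : ‖(γ (s + h)).1 - (eulerStep F h z).1‖ ≤
      ‖(γ s).1 - z.1‖ + |h| * ‖(γ s).2 - z.2‖ + B * |h| * |h| := by
    have : (γ (s + h)).1 - (eulerStep F h z).1 =
        ((γ s).1 - z.1) + h • ((γ s).2 - z.2) + ((γ (s + h)).1 - (γ s).1 - h • (γ s).2) := by
      simp only [eulerStep, smul_sub]; abel
    rw [this]
    refine (norm_add₃_le).trans ?_
    rw [norm_smul, Real.norm_eq_abs]
    gcongr
  have f2 : ‖(γ (s + h)).2 - (eulerStep F h z).2‖ ≤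
      ‖(γ s).2 - z.2‖ + |h| * (K * ‖(γ (s + h)).1 - (eulerStep F h z).1‖) +
        K * (B * |h|) * |h| := by
    have : (γ (s + h)).2 - (eulerStep F h z).2 =
        ((γ s).2 - z.2) + h • (F (γ (s + h)).1 - F (eulerStep F h z).1) +
          ((γ (s + h)).2 - (γ s).2 - h • F (γ (s + h)).1) := by
      simp only [eulerStep, smul_sub]; abel
    rw [this]
    refine (norm_add₃_le).trans ?_
    rw [norm_smul, Real.norm_eq_abs]
    gcongr
    exact hF.norm_sub_le _ _
  generalize ‖(γ (s + h)).1 - (eulerStep F h z).1‖ = A' at *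
  generalize ‖(γ (s + h)).2 - (eulerStep F h z).2‖ = B' at *
  have hA := norm_nonneg ((γ s).1 - z.1)
  have hC := norm_nonneg ((γ s).2 - z.2)
  generalize ‖(γ s).1 - z.1‖ = a at *
  generalize ‖(γ s).2 - z.2‖ = b at *
  have hh0 := abs_nonneg h
  generalize |h| = η at *
  have hKη : 0 ≤ (K : ℝ) * η := by positivity
  have g1 : (K : ℝ) * η * A' ≤ K * η * (a + b + B * η) := by
    refine mul_le_mul_of_nonneg_left ?_ hKη
    have : η * b ≤ 1 * b := mul_le_mul_of_nonneg_right hh hC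
    have : B * η * η ≤ B * η * 1 := mul_le_mul_of_nonneg_left hh (by positivity)
    linarith
  have g2 : 0 ≤ η * a := by positivity
  have g3 : 0 ≤ (K : ℝ) * η * (a + b) := by positivity
  nlinarith

/-- The symplectic Euler scheme converges along every solution. -/
lemma tendsto_eulerStep_iterate {F : Vec D → Vec D} {K : ℝ≥0} (hF : LipschitzWith K F)
    {γ : ℝ → Phase D} (hγ : ∀ s, HasDerivAt γ ((γ s).2, F (γ s).1) s) (t : ℝ) :
    Tendsto (fun n : ℕ => (eulerStep F (t / n))^[n] (γ 0)) atTop (𝓝 (γ t)) := by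
  have hcont : Continuous γ := continuous_iff_continuousAt.2 fun s => (hγ s).continuousAt
  obtain ⟨B, hB⟩ := (isCompact_Icc (a := -|t|) (b := |t|)).exists_bound_of_continuousOn
    (f := fun s => ((γ s).2, F (γ s).1))
    ((hcont.snd.prodMk (hF.continuous.comp hcont.fst)).continuousOn)
  have hB' : ∀ s ∈ Icc (-|t|) |t|, ‖(γ s).2‖ ≤ B ∧ ‖F (γ s).1‖ ≤ B := fun s hs =>
    ⟨(norm_fst_le _).trans (hB s hs), (norm_snd_le _).trans (hB s hs)⟩
  have hB0 : 0 ≤ B := (norm_nonneg _).trans (hB 0 (by simp))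
  set C : ℝ := 1 + 2 * K with hC
  have hC0 : 0 ≤ C := by positivity
  rw [tendsto_iff_norm_sub_tendsto_zero]
  have hlim : Tendsto (fun n : ℕ => C * B * |t| ^ 2 * Real.exp (C * |t|) / n) atTop (𝓝 0) :=
    tendsto_const_div_atTop_nhds_zero_nat _
  refine squeeze_zero' (Eventually.of_forall fun _ => norm_nonneg _) ?_ hlim
  obtain ⟨N, hN⟩ := exists_nat_ge |t|
  filter_upwards [eventually_ge_atTop N, eventually_gt_atTop 0] with n hn hn0
  have hn0' : (0 : ℝ) < n := by exact_mod_cast hn0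
  set h : ℝ := t / n with hh
  have hnh : n * |h| = |t| := by
    rw [hh, abs_div, Nat.abs_cast]; field_simp
  have hh1 : |h| ≤ 1 := by
    rw [hh, abs_div, Nat.abs_cast, div_le_one hn0']
    exact hN.trans (by exact_mod_cast hn)
  have hmem : ∀ k ≤ n, (k : ℝ) * h ∈ Icc (-|t|) |t| := by
    intro k hk
    rw [mem_Icc, ← abs_le, abs_mul, Nat.abs_cast, ← hnh]
    gcongr
  have key := le_mul_exp_of_le_one_add_mul_add (n := n)
    (u := fun k => ‖(γ (k * h)).1 - ((eulerStep F h)^[k] (γ 0)).1‖ +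
      ‖(γ (k * h)).2 - ((eulerStep F h)^[k] (γ 0)).2‖)
    (c := C * |h|) (b := C * B * |h| ^ 2) (by positivity) (by positivity) (by simp)
    (fun k hk => by
      have e : ((k + 1 : ℕ) : ℝ) * h = k * h + h := by push_cast; ring
      have := hmem (k + 1) hk
      rw [e] at this
      simp only [Function.iterate_succ_apply', e]
      exact eulerStep_error_le hF hγ hB' (hmem k hk.le) this hh1 _)
    n le_rfl
  have e : (n : ℝ) * h = t := by rw [hh]; field_simp
  rw [e] at key
  have e2 : n * (C * B * |h| ^ 2) * Real.exp (C * |h| * n) =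
      C * B * |t| ^ 2 * Real.exp (C * |t|) / n := by
    rw [show C * |h| * n = C * (n * |h|) by ring, hnh, ← hnh]
    field_simp
  rw [← e2]
  refine le_trans ?_ key
  rw [norm_sub_rev, Prod.norm_def]
  exact max_le_add_of_nonneg (norm_nonneg _) (norm_nonneg _)

lemma continuous_eulerStep {F : Vec D → Vec D} (hF : Continuous F) :
    Continuous (fun x : ℝ × Phase D => eulerStep F x.1 x.2) := by
  unfold eulerStep
  fun_prop

lemma continuous_eulerStep_iterate {F : Vec D → Vec D} (hF : Continuous F) (c : ℝ) (n : ℕ) :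
    Continuous (fun x : ℝ × Phase D => (eulerStep F (x.1 / c))^[n] x.2) := by
  induction n with
  | zero => exact continuous_snd
  | succ n ih =>
    simp only [Function.iterate_succ_apply']
    exact (continuous_eulerStep hF).comp ((continuous_fst.div_const c).prodMk ih)

/-- Each symplectic Euler step is a composition of two shears, so it preserves the volume. -/
lemma measurePreserving_eulerStep {F : Vec D → Vec D} (hF : Continuous F) (h : ℝ) :
    MeasurePreserving (eulerStep F h) (volume : Measure (Phase D)) volume := by
  have hs : ∀ G : Vec D → Vec D, Continuous G →
      MeasurePreserving (fun z : Phase D => (z.1, z.2 + G z.1)) volume volume := fun G hG =>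
    (MeasurePreserving.id volume).skew_product (g := fun q p => p + G q)
      (by have : Continuous (Function.uncurry fun (q p : Vec D) => p + G q) := by
            unfold Function.uncurry; fun_prop
          exact this.measurable)
      (ae_of_all _ fun q => (measurePreserving_add_right volume (G q)).map_eq)
  have h1 := hs (fun q => h • F q) (by fun_prop)
  have h2 := (Measure.measurePreserving_swap (μ := (volume : Measure (Vec D)))
    (ν := (volume : Measure (Vec D)))).comp ((hs (fun p => h • p) (by fun_prop)).comp
      (Measure.measurePreserving_swap (μ := (volume : Measure (Vec D)))
        (ν := (volume : Measure (Vec D)))))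
  exact h1.comp h2

end Euler

/-! ### Liouville's theorem -/

section Liouville

variable {D : ℕ} {Φ : Vec D → ℝ}

/-- The inequality `μ.map g ≤ μ` passes to pointwise limits: for an open set `U`, the preimage of
`U` under the limit is contained in the lower limit of the preimages, so Fatou's lemma applies, and
outer regularity extends the inequality to all measurable sets. -/
lemma map_le_of_tendsto {X : Type*} [TopologicalSpace X] [MeasurableSpace X] [BorelSpace X]
    {μ : Measure X} [μ.OuterRegular] {g : ℕ → X → X} {f : X → X} (hg : ∀ n, Measurable (g n))
    (hf : Measurable f) (hlim : ∀ x, Tendsto (fun n => g n x) atTop (𝓝 (f x)))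
    (hμ : ∀ n, μ.map (g n) ≤ μ) : μ.map f ≤ μ := by
  have hU : ∀ U, IsOpen U → μ (f ⁻¹' U) ≤ μ U := by
    intro U hU
    have h1 : ∀ x, (f ⁻¹' U).indicator (1 : X → ℝ≥0∞) x ≤
        liminf (fun n => (g n ⁻¹' U).indicator (1 : X → ℝ≥0∞) x) atTop := by
      intro x
      by_cases hx : f x ∈ U
      · refine le_liminf_of_le (by isBoundedDefault) ?_
        filter_upwards [(hlim x).eventually (hU.mem_nhds hx)] with n hn
        rw [indicator_of_mem (show x ∈ g n ⁻¹' U from hn),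
          indicator_of_mem (show x ∈ f ⁻¹' U from hx)]
      · simp [indicator, hx]
    calc μ (f ⁻¹' U) = ∫⁻ x, (f ⁻¹' U).indicator 1 x ∂μ :=
          (lintegral_indicator_one (hf hU.measurableSet)).symm
      _ ≤ ∫⁻ x, liminf (fun n => (g n ⁻¹' U).indicator (1 : X → ℝ≥0∞) x) atTop ∂μ :=
          lintegral_mono h1
      _ ≤ liminf (fun n => ∫⁻ x, (g n ⁻¹' U).indicator 1 x ∂μ) atTop :=
          lintegral_liminf_le fun n => measurable_one.indicator (hg n hU.measurableSet)
      _ ≤ μ U := by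
          refine liminf_le_of_le (by isBoundedDefault) fun b hb => ?_
          obtain ⟨n, hn⟩ := hb.exists
          rw [lintegral_indicator_one (hg n hU.measurableSet),
            ← Measure.map_apply (hg n) hU.measurableSet] at hn
          exact hn.trans (hμ n U)
  refine Measure.le_iff.2 fun s hs => ?_
  rw [Measure.map_apply hf hs, Set.measure_eq_iInf_isOpen s]
  exact le_iInf₂ fun U hsU => le_iInf fun hUo =>
    (measure_mono (preimage_mono hsU)).trans (hU U hUo)

/-- For a compactly supported potential both properties pass from the symplectic Euler iterates to
their limit. -/
lemma measurable_flow_and_map_le_of_hasCompactSupport (hΦ : ContDiff ℝ 2 Φ) (h0 : ∀ q, 0 ≤ Φ q)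
    (hc : HasCompactSupport Φ) :
    Measurable (fun x : ℝ × Phase D => flow Φ x.1 x.2) ∧
      ∀ t, (volume : Measure (Phase D)).map (flow Φ t) ≤ volume := by
  obtain ⟨K, hK⟩ := exists_lipschitzWith_gradient hΦ hc
  have hF : LipschitzWith K (fun q => -gradient Φ q) := hK.neg
  have hlim : ∀ (t : ℝ) (z : Phase D), Tendsto
      (fun n : ℕ => (eulerStep (fun q => -gradient Φ q) (t / n))^[n] z) atTop
        (𝓝 (flow Φ t z)) := by
    intro t z
    have := tendsto_eulerStep_iterate hF (isHamiltonianSolution_flow hΦ h0 z) t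
    simpa only [flow_zero hΦ h0] using this
  have hm : Measurable (fun x : ℝ × Phase D => flow Φ x.1 x.2) :=
    measurable_of_tendsto_metrizable
      (fun n : ℕ => (continuous_eulerStep_iterate hF.continuous (n : ℝ) n).measurable)
      (tendsto_pi_nhds.2 fun x => hlim x.1 x.2)
  refine ⟨hm, fun t => ?_⟩
  have hmp : ∀ n : ℕ, MeasurePreserving (eulerStep (fun q => -gradient Φ q) (t / n))^[n]
      (volume : Measure (Phase D)) volume := fun n =>
    (measurePreserving_eulerStep hF.continuous _).iterate n
  exact map_le_of_tendsto (fun n => (hmp n).measurable) (hm.comp measurable_prodMk_left)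
    (hlim t) (fun n => (hmp n).map_eq.le)

lemma measurable_flow (hΦ : ContDiff ℝ 2 Φ) (h0 : ∀ q, 0 ≤ Φ q) :
    Measurable (fun x : ℝ × Phase D => flow Φ x.1 x.2) :=
  measurable_of_tendsto_metrizable
    (fun n => (measurable_flow_and_map_le_of_hasCompactSupport (contDiff_cutoff hΦ n)
      (cutoff_nonneg h0 n) (hasCompactSupport_cutoff Φ n)).1)
    (tendsto_pi_nhds.2 fun x => tendsto_flow_cutoff hΦ h0 x.1 x.2)

lemma measurable_flow_apply (hΦ : ContDiff ℝ 2 Φ) (h0 : ∀ q, 0 ≤ Φ q) (t : ℝ) :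
    Measurable (flow Φ t) :=
  (measurable_flow hΦ h0).comp measurable_prodMk_left

lemma map_flow_volume_le (hΦ : ContDiff ℝ 2 Φ) (h0 : ∀ q, 0 ≤ Φ q) (t : ℝ) :
    (volume : Measure (Phase D)).map (flow Φ t) ≤ volume := by
  have h := fun n => measurable_flow_and_map_le_of_hasCompactSupport (contDiff_cutoff hΦ n)
      (cutoff_nonneg h0 n) (hasCompactSupport_cutoff Φ n)
  exact map_le_of_tendsto (fun n => (h n).1.comp measurable_prodMk_left)
    (measurable_flow_apply hΦ h0 t) (tendsto_flow_cutoff hΦ h0 t) (fun n => (h n).2 t)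

/-- Liouville's theorem. The inequality for the time `-t` gives the reverse inequality for the
time `t`. -/
theorem measurePreserving_flow (hΦ : ContDiff ℝ 2 Φ) (h0 : ∀ q, 0 ≤ Φ q) (t : ℝ) :
    MeasurePreserving (flow Φ t) (volume : Measure (Phase D)) volume := by
  have hm := measurable_flow_apply hΦ h0
  refine ⟨hm t, le_antisymm (map_flow_volume_le hΦ h0 t) ?_⟩
  have hid : flow Φ t ∘ flow Φ (-t) = id := by
    funext z
    simp [← flow_add hΦ h0, flow_zero hΦ h0]
  calc (volume : Measure (Phase D)) = (volume.map (flow Φ (-t))).map (flow Φ t) := by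
        rw [Measure.map_map (hm t) (hm (-t)), hid, Measure.map_id]
    _ ≤ volume.map (flow Φ t) := Measure.map_mono (map_flow_volume_le hΦ h0 (-t)) (hm t)

/-- The flow preserves the volume and the energy, hence the Boltzmann-Gibbs measure. -/
theorem measurePreserving_flow_boltzmannGibbs (hΦ : ContDiff ℝ 2 Φ) (h0 : ∀ q, 0 ≤ Φ q) (t : ℝ) :
    MeasurePreserving (flow Φ t) (boltzmannGibbs Φ) (boltzmannGibbs Φ) := by
  have hv := measurePreserving_flow hΦ h0 t
  refine ⟨hv.measurable, Measure.ext fun s hs => ?_⟩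
  have hρ : Measurable fun z : Phase D => ENNReal.ofReal ((normConst Φ)⁻¹ *
      (2 * Real.pi) ^ (-(D : ℝ) / 2) * Real.exp (-hamiltonian Φ z)) := by
    have := hΦ.continuous
    unfold hamiltonian
    fun_prop
  rw [Measure.map_apply hv.measurable hs, boltzmannGibbs, withDensity_apply _ (hv.measurable hs),
    withDensity_apply _ hs, ← hv.setLIntegral_comp_preimage hs hρ]
  simp only [hamiltonian_flow hΦ h0]

end Liouville

/-! ### Structure of the Boltzmann-Gibbs measure -/

section Gaussian

variable {D : ℕ} {Φ : Vec D → ℝ}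

/-- The density of the standard Gaussian measure, by comparison of characteristic functions. -/
lemma withDensity_gaussian_eq_stdGaussian :
    (volume : Measure (Vec D)).withDensity (fun p => ENNReal.ofReal
      ((2 * Real.pi) ^ (-(D : ℝ) / 2) * Real.exp (-(‖p‖ ^ 2 / 2)))) = stdGaussian (Vec D) := by
  have hint : Integrable (fun p : Vec D =>
      (2 * Real.pi) ^ (-(D : ℝ) / 2) * Real.exp (-(‖p‖ ^ 2 / 2))) := by
    have := (GaussianFourier.integrable_cexp_neg_mul_sq_norm_add (V := Vec D) (b := 1 / 2)
      (by norm_num) 0 0).re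
    refine (this.congr (ae_of_all _ fun p => ?_)).const_mul _
    have e : (-(1 / 2 : ℂ) * (‖p‖ : ℂ) ^ 2 + 0 * (inner ℝ (0 : Vec D) p : ℝ)) =
        ((-(‖p‖ ^ 2 / 2) : ℝ) : ℂ) := by push_cast; ring
    simp only [e, ← Complex.ofReal_exp]
    exact Complex.ofReal_re _
  have hm : Measurable (fun p : Vec D => ENNReal.ofReal
      ((2 * Real.pi) ^ (-(D : ℝ) / 2) * Real.exp (-(‖p‖ ^ 2 / 2)))) := by fun_prop
  have hfin : IsFiniteMeasure ((volume : Measure (Vec D)).withDensity (fun p => ENNReal.ofReal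
      ((2 * Real.pi) ^ (-(D : ℝ) / 2) * Real.exp (-(‖p‖ ^ 2 / 2))))) :=
    isFiniteMeasure_withDensity_ofReal hint.2
  refine Measure.ext_of_charFun ?_
  funext t
  rw [charFun_stdGaussian, charFun_apply,
    integral_withDensity_eq_integral_toReal_smul hm (ae_of_all _ fun _ => ENNReal.ofReal_lt_top)]
  have hpi : (0 : ℝ) < 2 * Real.pi := by positivity
  have h := GaussianFourier.integral_cexp_neg_mul_sq_norm_add (V := Vec D) (b := 1 / 2)
    (by norm_num) Complex.I t
  have e : ∀ p : Vec D, (ENNReal.ofReal ((2 * Real.pi) ^ (-(D : ℝ) / 2) *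
      Real.exp (-(‖p‖ ^ 2 / 2)))).toReal • Complex.exp ((inner ℝ p t : ℝ) * Complex.I) =
      (((2 * Real.pi) ^ (-(D : ℝ) / 2) : ℝ) : ℂ) *
        Complex.exp (-(1 / 2) * (‖p‖ : ℂ) ^ 2 + Complex.I * (inner ℝ t p : ℝ)) := by
    intro p
    rw [ENNReal.toReal_ofReal (by positivity), Complex.exp_add, Complex.real_smul,
      real_inner_comm]
    push_cast
    rw [mul_comm Complex.I, mul_assoc]
    congr 3
    ring_nf
  simp only [e]
  rw [integral_const_mul, h]
  have e2 : (Real.pi / (1 / 2 : ℂ)) ^ ((Module.finrank ℝ (Vec D) : ℂ) / 2) =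
      (((2 * Real.pi) ^ ((D : ℝ) / 2) : ℝ) : ℂ) := by
    rw [Complex.ofReal_cpow hpi.le]
    simp only [finrank_euclideanSpace, Fintype.card_fin]
    push_cast
    congr 1
    ring
  rw [e2, ← mul_assoc, ← Complex.ofReal_mul, ← Real.rpow_add hpi]
  rw [show -(D : ℝ) / 2 + D / 2 = 0 by ring, Real.rpow_zero, Complex.I_sq]
  push_cast
  rw [one_mul]
  congr 1
  ring

/-- Momentum randomization preserves the standard Gaussian measure since `cos² φ + sin² φ = 1`. -/
lemma measurePreserving_cos_smul_add_sin_smul (φ : ℝ) :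
    MeasurePreserving (fun x : Vec D × Vec D => Real.cos φ • x.1 + Real.sin φ • x.2)
      ((stdGaussian (Vec D)).prod (stdGaussian (Vec D))) (stdGaussian (Vec D)) := by
  have hm : Measurable (fun x : Vec D × Vec D => Real.cos φ • x.1 + Real.sin φ • x.2) := by
    fun_prop
  refine ⟨hm, ?_⟩
  have := Measure.isProbabilityMeasure_map
    (μ := (stdGaussian (Vec D)).prod (stdGaussian (Vec D))) hm.aemeasurable
  refine Measure.ext_of_charFun ?_
  funext t
  rw [charFun_apply, integral_map hm.aemeasurable (by fun_prop)]
  have e : ∀ x : Vec D × Vec D,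
      Complex.exp ((inner ℝ (Real.cos φ • x.1 + Real.sin φ • x.2) t : ℝ) * Complex.I) =
      Complex.exp ((inner ℝ x.1 (Real.cos φ • t) : ℝ) * Complex.I) *
        Complex.exp ((inner ℝ x.2 (Real.sin φ • t) : ℝ) * Complex.I) := by
    intro x
    rw [← Complex.exp_add, ← add_mul, ← Complex.ofReal_add]
    simp only [inner_add_left, real_inner_smul_left, real_inner_smul_right]
  simp only [e]
  rw [integral_prod_mul
    (fun x : Vec D => Complex.exp ((inner ℝ x (Real.cos φ • t) : ℝ) * Complex.I))
    (fun x : Vec D => Complex.exp ((inner ℝ x (Real.sin φ • t) : ℝ) * Complex.I)),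
    ← charFun_apply, ← charFun_apply]
  simp only [charFun_stdGaussian]
  rw [← Complex.exp_add, norm_smul, norm_smul]
  congr 1
  have h1 : (Real.cos φ : ℝ) ^ 2 * ‖t‖ ^ 2 + Real.sin φ ^ 2 * ‖t‖ ^ 2 = ‖t‖ ^ 2 := by
    rw [← add_mul, Real.cos_sq_add_sin_sq, one_mul]
  simp only [Real.norm_eq_abs, ← Complex.ofReal_pow, mul_pow, sq_abs]
  conv_rhs => rw [← h1]
  push_cast
  ring

/-- On the unit ball `exp(-Φ) ≤ 1`, and outside it `exp(-Φ)` is at most the integrand of `H1`. -/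
lemma integrable_exp_neg_of_H1 (hΦ : Continuous Φ) (h1 : H1 Φ) :
    Integrable (fun q => Real.exp (-Φ q)) := by
  have hb : Integrable ((Metric.closedBall (0 : Vec D) 1).indicator fun _ => (1 : ℝ)) :=
    (integrable_indicator_iff Metric.isClosed_closedBall.measurableSet).2
      (integrableOn_const (isCompact_closedBall _ _).measure_lt_top.ne)
  refine (hb.add h1.2).mono' (by fun_prop) (ae_of_all _ fun q => ?_)
  rw [Real.norm_of_nonneg (Real.exp_nonneg _), Pi.add_apply]
  by_cases hq : ‖q‖ ≤ 1
  · rw [indicator_of_mem (by simpa using hq)]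
    have : Real.exp (-Φ q) ≤ 1 := Real.exp_le_one_iff.2 (by linarith [h1.1 q])
    have : 0 ≤ ‖q‖ ^ 2 * Real.exp (-Φ q) := by positivity
    linarith
  · rw [indicator_of_notMem (by simpa using hq), zero_add]
    exact le_mul_of_one_le_left (Real.exp_nonneg _) (one_le_pow₀ (not_le.1 hq).le)

/-- The position marginal `C₀⁻¹ exp(-Φ(q)) dq` of the Boltzmann-Gibbs measure. -/
noncomputable def positionGibbs (Φ : Vec D → ℝ) : Measure (Vec D) :=
  volume.withDensity fun q => ENNReal.ofReal ((normConst Φ)⁻¹ * Real.exp (-Φ q))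

lemma isProbabilityMeasure_positionGibbs (hΦ : Continuous Φ) (h1 : H1 Φ) :
    IsProbabilityMeasure (positionGibbs Φ) := by
  have hint := integrable_exp_neg_of_H1 hΦ h1
  have hpos : 0 < normConst Φ := integral_exp_pos hint
  refine ⟨?_⟩
  rw [positionGibbs, withDensity_apply _ MeasurableSet.univ, Measure.restrict_univ,
    ← ofReal_integral_eq_lintegral_ofReal (hint.const_mul _) (ae_of_all _ fun q => by positivity),
    integral_const_mul]
  change ENNReal.ofReal ((normConst Φ)⁻¹ * normConst Φ) = 1
  rw [inv_mul_cancel₀ hpos.ne', ENNReal.ofReal_one]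

/-- Positions and momenta are independent under the Boltzmann-Gibbs measure, and the momenta are
standard Gaussian. -/
lemma boltzmannGibbs_eq_prod (hΦ : Continuous Φ) (h1 : H1 Φ) :
    boltzmannGibbs Φ = (positionGibbs Φ).prod (stdGaussian (Vec D)) := by
  have := isProbabilityMeasure_positionGibbs hΦ h1
  have hpos : 0 ≤ normConst Φ := integral_nonneg fun _ => Real.exp_nonneg _
  have hsf : SFinite ((volume : Measure (Vec D)).withDensity (fun p => ENNReal.ofReal
      ((2 * Real.pi) ^ (-(D : ℝ) / 2) * Real.exp (-(‖p‖ ^ 2 / 2))))) := by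
    rw [withDensity_gaussian_eq_stdGaussian]; infer_instance
  rw [← withDensity_gaussian_eq_stdGaussian, positionGibbs,
    prod_withDensity (by fun_prop) (by fun_prop), boltzmannGibbs, Measure.volume_eq_prod]
  congr 1
  funext z
  rw [← ENNReal.ofReal_mul (by positivity), hamiltonian, neg_add, Real.exp_add]
  congr 1
  ring

lemma isProbabilityMeasure_boltzmannGibbs (hΦ : Continuous Φ) (h1 : H1 Φ) :
    IsProbabilityMeasure (boltzmannGibbs Φ) := by
  have := isProbabilityMeasure_positionGibbs hΦ h1
  rw [boltzmannGibbs_eq_prod hΦ h1]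
  infer_instance

lemma continuous_refresh (φ : ℝ) :
    Continuous (fun x : Vec D × Phase D => refresh φ x.1 x.2) := by
  unfold refresh
  fun_prop

/-- The Boltzmann-Gibbs measure is invariant under the momentum randomization kernel. -/
lemma lintegral_refresh_boltzmannGibbs (hΦ : Continuous Φ) (h1 : H1 Φ) (φ : ℝ)
    {g : Phase D → ℝ≥0∞} (hg : Measurable g) :
    ∫⁻ z, ∫⁻ x, g (refresh φ x z) ∂stdGaussian (Vec D) ∂boltzmannGibbs Φ =
      ∫⁻ z, g z ∂boltzmannGibbs Φ := by
  have := isProbabilityMeasure_positionGibbs hΦ h1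
  have hm : Measurable (fun x : Phase D × Vec D => g (refresh φ x.2 x.1)) :=
    hg.comp ((continuous_refresh φ).measurable.comp measurable_swap)
  rw [boltzmannGibbs_eq_prod hΦ h1, lintegral_prod _ hm.lintegral_prod_right'.aemeasurable,
    lintegral_prod _ hg.aemeasurable]
  refine lintegral_congr fun q => ?_
  have hgq : Measurable fun p => g (q, p) := hg.comp measurable_prodMk_left
  rw [← (measurePreserving_cos_smul_add_sin_smul φ).lintegral_comp hgq, lintegral_prod]
  · rfl
  · exact (hgq.comp (measurePreserving_cos_smul_add_sin_smul φ).measurable).aemeasurable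

end Gaussian

/-! ### The randomized process -/

section Path

variable {D : ℕ} {Φ : Vec D → ℝ}

lemma measurable_stateAtJump (hΦ : ContDiff ℝ 2 Φ) (h0 : ∀ q, 0 ≤ Φ q) (φ : ℝ) (k : ℕ) :
    Measurable (fun x : ((ℕ → ℝ) × (ℕ → Vec D)) × Phase D =>
      stateAtJump Φ φ x.1.1 x.1.2 x.2 k) := by
  induction k with
  | zero => exact measurable_snd
  | succ k ih =>
    simp only [stateAtJump]
    have h1 : Measurable (fun x : ((ℕ → ℝ) × (ℕ → Vec D)) × Phase D => x.1.1 k) := by fun_prop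
    have h2 : Measurable (fun x : ((ℕ → ℝ) × (ℕ → Vec D)) × Phase D => x.1.2 k) := by fun_prop
    exact (continuous_refresh φ).measurable.comp
      (h2.prodMk ((measurable_flow hΦ h0).comp (h1.prodMk ih)))

lemma measurable_jumpTime (k : ℕ) : Measurable (fun δ : ℕ → ℝ => jumpTime δ k) := by
  unfold jumpTime
  fun_prop

/-- The restriction `n ≠ 0` is needed since `sSup` also takes the value `0` on the empty and on
unbounded sets. -/
lemma numJumps_eq_iff (δ : ℕ → ℝ) (t : ℝ) {n : ℕ} (hn : n ≠ 0) :
    numJumps δ t = n ↔ jumpTime δ n ≤ t ∧ ∀ k, n < k → ¬ jumpTime δ k ≤ t := by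
  unfold numJumps
  constructor
  · intro h
    by_cases hb : BddAbove {k : ℕ | jumpTime δ k ≤ t}
    · have hne : {k : ℕ | jumpTime δ k ≤ t}.Nonempty := by
        by_contra hne
        rw [not_nonempty_iff_eq_empty] at hne
        rw [hne, csSup_empty] at h
        exact hn h.symm
      have := Nat.sSup_mem hne hb
      rw [h] at this
      refine ⟨this, fun k hk hk' => ?_⟩
      have := le_csSup hb hk'
      omega
    · rw [Nat.sSup_of_not_bddAbove hb] at h
      exact absurd h.symm hn
  · rintro ⟨h1, h2⟩
    exact IsGreatest.csSup_eq ⟨h1, fun k hk => not_lt.1 fun h => h2 k h hk⟩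

lemma measurable_numJumps (t : ℝ) : Measurable (fun δ : ℕ → ℝ => numJumps δ t) := by
  have h : ∀ n : ℕ, n ≠ 0 → MeasurableSet ((fun δ : ℕ → ℝ => numJumps δ t) ⁻¹' {n}) := by
    intro n hn
    have e : (fun δ : ℕ → ℝ => numJumps δ t) ⁻¹' {n} =
        {δ | jumpTime δ n ≤ t} ∩ ⋂ k, ⋂ (_ : n < k), {δ | jumpTime δ k ≤ t}ᶜ := by
      ext δ
      simp only [mem_preimage, mem_singleton_iff, numJumps_eq_iff δ t hn, mem_inter_iff, mem_iInter,
        mem_compl_iff]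
      rfl
    rw [e]
    exact (measurableSet_le (measurable_jumpTime n) measurable_const).inter
      (MeasurableSet.iInter fun k => MeasurableSet.iInter fun _ =>
        (measurableSet_le (measurable_jumpTime k) measurable_const).compl)
  refine measurable_to_countable' fun n => ?_
  rcases eq_or_ne n 0 with rfl | hn
  · have e : (fun δ : ℕ → ℝ => numJumps δ t) ⁻¹' {0} =
        (⋃ n, ⋃ (_ : n ≠ 0), (fun δ : ℕ → ℝ => numJumps δ t) ⁻¹' {n})ᶜ := by
      ext δ
      simp only [mem_preimage, mem_singleton_iff, mem_compl_iff, mem_iUnion, not_exists]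
      grind
    rw [e]
    exact (MeasurableSet.iUnion fun n => MeasurableSet.iUnion fun hn => h n hn).compl
  · exact h n hn

lemma measurable_path (hΦ : ContDiff ℝ 2 Φ) (h0 : ∀ q, 0 ≤ Φ q) (φ t : ℝ) :
    Measurable (fun x : ((ℕ → ℝ) × (ℕ → Vec D)) × Phase D => path Φ φ x.1.1 x.1.2 x.2 t) := by
  have h : Measurable (fun y : ℕ × (((ℕ → ℝ) × (ℕ → Vec D)) × Phase D) =>
      flow Φ (t - jumpTime y.2.1.1 y.1) (stateAtJump Φ φ y.2.1.1 y.2.1.2 y.2.2 y.1)) := by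
    refine measurable_from_prod_countable_right fun n => ?_
    have h1 : Measurable (fun x : ((ℕ → ℝ) × (ℕ → Vec D)) × Phase D => t - jumpTime x.1.1 n) :=
      measurable_const.sub ((measurable_jumpTime n).comp (measurable_fst.comp measurable_fst))
    exact (measurable_flow hΦ h0).comp (h1.prodMk (measurable_stateAtJump hΦ h0 φ n))
  exact h.comp (((measurable_numJumps t).comp (measurable_fst.comp measurable_fst)).prodMk
    measurable_id)

lemma measurable_path_comp {X : Type*} [MeasurableSpace X] {d : X → ℕ → ℝ} {x : X → ℕ → Vec D}
    {z : X → Phase D} (hΦ : ContDiff ℝ 2 Φ) (h0 : ∀ q, 0 ≤ Φ q) (φ t : ℝ) (hd : Measurable d)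
    (hx : Measurable x) (hz : Measurable z) :
    Measurable fun a => path Φ φ (d a) (x a) (z a) t := by
  have hm : Measurable fun a => ((d a, x a), z a) := (hd.prodMk hx).prodMk hz
  have h := (measurable_path hΦ h0 φ t).comp hm
  exact h

lemma stateAtJump_congr (φ : ℝ) (d : ℕ → ℝ) {x y : ℕ → Vec D} (z : Phase D) {k : ℕ}
    (h : ∀ i < k, x i = y i) : stateAtJump Φ φ d x z k = stateAtJump Φ φ d y z k := by
  induction k with
  | zero => rfl
  | succ k ih =>
    simp only [stateAtJump]
    rw [ih fun i hi => h i (hi.trans k.lt_succ_self), h k k.lt_succ_self]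

/-- The law of a sequence of independent standard Gaussian vectors. -/
noncomputable def gaussianSeq (D : ℕ) : Measure (ℕ → Vec D) :=
  Measure.infinitePi fun _ => stdGaussian (Vec D)

instance : IsProbabilityMeasure (gaussianSeq D) := by
  unfold gaussianSeq; infer_instance

/-- For deterministic durations and a fixed initial state, the state after `k` randomizations
depends only on the first `k` Gaussian vectors, hence is independent of the next one. -/
lemma indepFun_stateAtJump_eval (hΦ : ContDiff ℝ 2 Φ) (h0 : ∀ q, 0 ≤ Φ q) (φ : ℝ) (d : ℕ → ℝ)
    (z : Phase D) (k : ℕ) :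
    IndepFun (fun x : ℕ → Vec D => stateAtJump Φ φ d x z k) (fun x => x k) (gaussianSeq D) := by
  have hi : iIndepFun (fun (i : ℕ) (x : ℕ → Vec D) => x i) (gaussianSeq D) :=
    iIndepFun_infinitePi (P := fun _ => stdGaussian (Vec D)) (X := fun _ v => v)
      (fun _ => measurable_id)
  have := hi.indepFun_finset (Finset.range k) {k} (by simp) (fun i => measurable_pi_apply i)
  -- the Gaussian vectors with index at least `k` do not matter, so they can be replaced by zero
  let ext : (Finset.range k → Vec D) → ℕ → Vec D := fun v i =>
    if h : i ∈ Finset.range k then v ⟨i, h⟩ else 0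
  have hext : Measurable ext := measurable_pi_lambda _ fun i => by
    by_cases h : i ∈ Finset.range k
    · simpa only [ext, dif_pos h] using measurable_pi_apply _
    · simpa only [ext, dif_neg h] using measurable_const
  have hF : Measurable fun v => stateAtJump Φ φ d (ext v) z k :=
    (measurable_stateAtJump hΦ h0 φ k).comp
      ((measurable_const.prodMk hext).prodMk measurable_const)
  have h2 := this.comp hF (measurable_pi_apply (⟨k, by simp⟩ : ({k} : Finset ℕ)))
  refine h2.congr (Eventually.of_forall fun x => ?_) (Eventually.of_forall fun x => rfl)
  symm
  refine stateAtJump_congr φ d z fun i hi => ?_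
  simp [ext, hi]

/-- For deterministic durations, the state after `k` randomizations has the Boltzmann-Gibbs law if
the initial state has. -/
lemma lintegral_stateAtJump (hΦ : ContDiff ℝ 2 Φ) (h1 : H1 Φ) (φ : ℝ) (d : ℕ → ℝ) (k : ℕ)
    {g : Phase D → ℝ≥0∞} (hg : Measurable g) :
    ∫⁻ z, ∫⁻ x, g (stateAtJump Φ φ d x z k) ∂gaussianSeq D ∂boltzmannGibbs Φ =
      ∫⁻ z, g z ∂boltzmannGibbs Φ := by
  induction k generalizing g with
  | zero => simp [stateAtJump]
  | succ k ih =>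
    have hst : ∀ z, Measurable fun x : ℕ → Vec D => stateAtJump Φ φ d x z k := fun z =>
      (measurable_stateAtJump hΦ h1.1 φ k).comp
        ((measurable_const.prodMk measurable_id).prodMk measurable_const)
    have hfl := measurable_flow_apply hΦ h1.1 (d k)
    have hr : Measurable fun y : Phase D × Vec D => g (refresh φ y.2 y.1) :=
      hg.comp ((continuous_refresh φ).measurable.comp measurable_swap)
    have hG : Measurable fun y => ∫⁻ x, g (refresh φ x y) ∂stdGaussian (Vec D) :=
      hr.lintegral_prod_right'
    have hrf : Measurable fun y : Phase D × Vec D => g (refresh φ y.2 (flow Φ (d k) y.1)) :=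
      hr.comp ((hfl.comp measurable_fst).prodMk measurable_snd)
    -- integrate out the last Gaussian vector first
    have step : ∀ z, ∫⁻ x, g (stateAtJump Φ φ d x z (k + 1)) ∂gaussianSeq D =
        ∫⁻ x, (∫⁻ v, g (refresh φ v (flow Φ (d k) (stateAtJump Φ φ d x z k)))
          ∂stdGaussian (Vec D)) ∂gaussianSeq D := by
      intro z
      have hi := (indepFun_iff_map_prod_eq_prod_map_map (hst z).aemeasurable
        (measurable_pi_apply k).aemeasurable).1 (indepFun_stateAtJump_eval hΦ h1.1 φ d z k)
      have hev : (gaussianSeq D).map (fun x => x k) = stdGaussian (Vec D) :=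
        Measure.infinitePi_map_eval (μ := fun _ : ℕ => stdGaussian (Vec D)) k
      rw [hev] at hi
      have := lintegral_map (μ := gaussianSeq D) hrf ((hst z).prodMk (measurable_pi_apply k))
      rw [hi, lintegral_prod _ hrf.aemeasurable,
        lintegral_map hrf.lintegral_prod_right' (hst z)] at this
      exact this.symm
    simp only [step]
    rw [ih (g := fun y => ∫⁻ v, g (refresh φ v (flow Φ (d k) y)) ∂stdGaussian (Vec D))
      (hG.comp hfl),
      (measurePreserving_flow_boltzmannGibbs hΦ h1.1 (d k)).lintegral_comp hG]
    exact lintegral_refresh_boltzmannGibbs hΦ.continuous h1 φ hg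

/-- The Boltzmann-Gibbs measure is invariant for durations of an arbitrary joint law `ν`, as long as
the Gaussian vectors are independent of the durations: for given durations, the number of
randomizations up to time `t` is not random. -/
lemma lintegral_path (hΦ : ContDiff ℝ 2 Φ) (h1 : H1 Φ) (φ t : ℝ) (ν : Measure (ℕ → ℝ))
    [IsProbabilityMeasure ν] {g : Phase D → ℝ≥0∞} (hg : Measurable g) :
    ∫⁻ z, ∫⁻ x, g (path Φ φ x.1 x.2 z t) ∂ν.prod (gaussianSeq D) ∂boltzmannGibbs Φ =
      ∫⁻ z, g z ∂boltzmannGibbs Φ := by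
  have := isProbabilityMeasure_boltzmannGibbs hΦ.continuous h1
  have hp2 : Measurable fun y : Phase D × ((ℕ → ℝ) × (ℕ → Vec D)) =>
      g (path Φ φ y.2.1 y.2.2 y.1 t) :=
    hg.comp (measurable_path_comp hΦ h1.1 φ t (measurable_fst.comp measurable_snd)
      (measurable_snd.comp measurable_snd) measurable_fst)
  have hp3 : Measurable fun y : (Phase D × (ℕ → ℝ)) × (ℕ → Vec D) =>
      g (path Φ φ y.1.2 y.2 y.1.1 t) :=
    hg.comp (measurable_path_comp hΦ h1.1 φ t (measurable_snd.comp measurable_fst) measurable_snd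
      (measurable_fst.comp measurable_fst))
  calc ∫⁻ z, ∫⁻ x, g (path Φ φ x.1 x.2 z t) ∂ν.prod (gaussianSeq D) ∂boltzmannGibbs Φ
      = ∫⁻ z, ∫⁻ d, ∫⁻ x, g (path Φ φ d x z t) ∂gaussianSeq D ∂ν ∂boltzmannGibbs Φ := by
        refine lintegral_congr fun z => ?_
        exact lintegral_prod _ (hp2.comp measurable_prodMk_left).aemeasurable
    _ = ∫⁻ d, ∫⁻ z, ∫⁻ x, g (path Φ φ d x z t) ∂gaussianSeq D ∂boltzmannGibbs Φ ∂ν :=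
        lintegral_lintegral_swap (hp3.lintegral_prod_right').aemeasurable
    _ = ∫⁻ _, ∫⁻ z, g z ∂boltzmannGibbs Φ ∂ν := by
        refine lintegral_congr fun d => ?_
        have hfl := measurePreserving_flow_boltzmannGibbs hΦ h1.1 (t - jumpTime d (numJumps d t))
        exact (lintegral_stateAtJump hΦ h1 φ d (numJumps d t)
          (hg.comp hfl.measurable)).trans (hfl.lintegral_comp hg)
    _ = ∫⁻ z, g z ∂boltzmannGibbs Φ := by simp

lemma measurePreserving_path (hΦ : ContDiff ℝ 2 Φ) (h1 : H1 Φ) (φ t : ℝ) (ν : Measure (ℕ → ℝ))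
    [IsProbabilityMeasure ν] :
    MeasurePreserving (fun y : Phase D × ((ℕ → ℝ) × (ℕ → Vec D)) => path Φ φ y.2.1 y.2.2 y.1 t)
      ((boltzmannGibbs Φ).prod (ν.prod (gaussianSeq D))) (boltzmannGibbs Φ) := by
  have hm : Measurable fun y : Phase D × ((ℕ → ℝ) × (ℕ → Vec D)) => path Φ φ y.2.1 y.2.2 y.1 t :=
    measurable_path_comp hΦ h1.1 φ t (measurable_fst.comp measurable_snd)
      (measurable_snd.comp measurable_snd) measurable_fst
  have := isProbabilityMeasure_boltzmannGibbs hΦ.continuous h1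
  refine ⟨hm, Measure.ext_of_lintegral _ fun g hg => ?_⟩
  have hgm : Measurable fun y : Phase D × ((ℕ → ℝ) × (ℕ → Vec D)) =>
    g (path Φ φ y.2.1 y.2.2 y.1 t) := hg.comp hm
  rw [lintegral_map hg hm, lintegral_prod _ hgm.aemeasurable]
  exact lintegral_path hΦ h1 φ t ν hg

end Path

/-! ### The joint law of the noise -/

section Noise

variable {D : ℕ} {Ω : Type*} [MeasurableSpace Ω] {P : Measure Ω} {lam : ℝ} {δ : ℕ → Ω → ℝ}
  {ξ : ℕ → Ω → Vec D}

lemma IsNoise.aemeasurable (h : IsNoise P lam δ ξ) :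
    AEMeasurable (fun ω => ((fun k => δ k ω), (fun k => ξ k ω))) P :=
  (aemeasurable_pi_iff.2 fun k => (h.law_duration k).aemeasurable).prodMk
    (aemeasurable_pi_iff.2 fun k => (h.law_gaussian k).aemeasurable)

lemma IsNoise.map_eq [IsProbabilityMeasure P] (h : IsNoise P lam δ ξ) :
    P.map (fun ω => ((fun k => δ k ω), (fun k => ξ k ω))) =
      (P.map fun ω k => δ k ω).prod (gaussianSeq D) := by
  rw [(indepFun_iff_map_prod_eq_prod_map_map
    (aemeasurable_pi_iff.2 fun k => (h.law_duration k).aemeasurable)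
    (aemeasurable_pi_iff.2 fun k => (h.law_gaussian k).aemeasurable)).1 h.indep,
    h.indep_gaussian.map_fun_eq_infinitePi_map₀' fun k => (h.law_gaussian k).aemeasurable]
  simp only [(h.law_gaussian _).map_eq, gaussianSeq]

end Noise

end RHMC

theorem mainTheorem4 {D : ℕ} {Φ : RHMC.Vec D → ℝ} {lam φ : ℝ}
    (hlam : 0 < lam) (hφ : φ ∈ Set.Ioc 0 (Real.pi / 2))
    (hΦ : ContDiff ℝ 2 Φ) (h1 : RHMC.H1 Φ) (h2 : RHMC.H2 Φ lam φ)
    {Ω : Type*} [MeasurableSpace Ω] (P : MeasureTheory.Measure Ω)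
    [MeasureTheory.IsProbabilityMeasure P]
    {δ : ℕ → Ω → ℝ} {ξ : ℕ → Ω → RHMC.Vec D} (hnoise : RHMC.IsNoise P lam δ ξ)
    (f : RHMC.Phase D → ℝ) (hf : ContDiff ℝ (⊤ : ℕ∞) f) (hfc : HasCompactSupport f)
    (t : ℝ) (ht : 0 < t) :
    MeasureTheory.IsProbabilityMeasure (RHMC.boltzmannGibbs Φ) ∧
    (∀ z, MeasureTheory.Integrable
      (fun ω => f (RHMC.path Φ φ (fun k => δ k ω) (fun k => ξ k ω) z t)) P) ∧
    MeasureTheory.Integrable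
      (fun z => ∫ ω, f (RHMC.path Φ φ (fun k => δ k ω) (fun k => ξ k ω) z t) ∂P)
      (RHMC.boltzmannGibbs Φ) ∧
    ∫ z, (∫ ω, f (RHMC.path Φ φ (fun k => δ k ω) (fun k => ξ k ω) z t) ∂P)
        ∂(RHMC.boltzmannGibbs Φ) =
      ∫ z, f z ∂(RHMC.boltzmannGibbs Φ) := by
  open MeasureTheory RHMC in
  have hBG := isProbabilityMeasure_boltzmannGibbs hΦ.continuous h1
  have hν : IsProbabilityMeasure (P.map fun ω k => δ k ω) :=
    Measure.isProbabilityMeasure_map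
      (aemeasurable_pi_iff.2 fun k => (hnoise.law_duration k).aemeasurable)
  set ν := P.map fun ω k => δ k ω with hνdef
  have hmp := measurePreserving_path hΦ h1 φ t ν
  obtain ⟨C, hC⟩ := hfc.exists_bound_of_continuous hf.continuous
  have hfm : Measurable f := hf.continuous.measurable
  have hz : ∀ z, Measurable fun x : (ℕ → ℝ) × (ℕ → Vec D) => f (path Φ φ x.1 x.2 z t) := fun z =>
    hfm.comp (measurable_path_comp hΦ h1.1 φ t measurable_fst measurable_snd measurable_const)
  -- expectations only depend on the joint law of the noise
  have hE : ∀ z, ∫ ω, f (path Φ φ (fun k => δ k ω) (fun k => ξ k ω) z t) ∂P =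
      ∫ x, f (path Φ φ x.1 x.2 z t) ∂ν.prod (gaussianSeq D) := by
    intro z
    rw [← hnoise.map_eq, integral_map hnoise.aemeasurable (hz z).aestronglyMeasurable]
  have hint : Integrable (fun y : Phase D × ((ℕ → ℝ) × (ℕ → Vec D)) =>
      f (path Φ φ y.2.1 y.2.2 y.1 t))
        ((boltzmannGibbs Φ).prod (ν.prod (gaussianSeq D))) :=
    Integrable.of_bound (hfm.comp hmp.measurable).aestronglyMeasurable C (ae_of_all _ fun _ => hC _)
  simp only [hE]
  refine ⟨hBG, fun z => ?_, hint.integral_prod_left, ?_⟩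
  · exact Integrable.of_bound ((hz z).comp_aemeasurable hnoise.aemeasurable).aestronglyMeasurable C
      (ae_of_all _ fun _ => hC _)
  · rw [← integral_prod _ hint, ← integral_map hmp.measurable.aemeasurable
      hfm.aestronglyMeasurable, hmp.map_eq]
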